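/- Let $1 \le d < D$ and let $M \subset \mathbb{R}^D$ be a compact connected $d$-dimensional embedded submanifold without boundary, of class $C^k$ for some $k \in \{1,2,\dots,\infty,\omega\}$, where $\mathbb{R}^D$ carries the Euclidean norm. For $x\in M$ let $T_xM \subset \mathbb{R}^D$ be the tangent space (a linear subspace), and let $d_M(p,q)$ be the geodesic distance on $M$, i.e. the infimum of the lengths $\int_0^1\|\gamma'(t)\|\,dt$ over the $C^1$ paths $\gamma:[0,1]\to M$ from $p$ to $q$. For a point $z$ and a set $A$ write $d(z,A)=\inf_{p\in A}\|p-z\|$. Let $$\mathrm{Med}(M)=\{z\in\mathbb{R}^D : \exists\, p\ne q\in M,\ \|p-z\|=\|q-z\|=d(z,M)\},\qquad \tau_M=\inf_{z\in \mathrm{Med}(M)} d(z,M)\in[0,\infty]$$ be the medial axis and the reach of $M$, and assume $\tau_M>0$. For $\mathbb{X}\subset M$ define $$\hat\tau(\mathbb{X})=\inf_{x\neq y\in\mathbb{X}}\frac{\|y-x\|^2}{2\,d(y-x,T_xM)}\in[0,\infty],$$ where a term with $y-x\in T_xM$ equals $\infty$, and where $1/\infty=0$. Suppose that $M$ has a bottleneck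 $(q_1,q_2)\in M^2$: there is $z_0\in\mathrm{Med}(M)$ with $\|q_1-z_0\|\le\tau_M$ and $\|q_2-z_0\|\le\tau_M$, and $\|q_1-q_2\|=2\tau_M$. Let $\mathbb{X}\subset M$ contain points $x,y$ with $\|q_1-x\|<\tau_M$ and $\|q_2-y\|<\tau_M$. Then $$0\le\frac1{\tau_M}-\frac1{\hat\tau(\mathbb{X})}\le\frac1{\tau_M}-\frac1{\hat\tau(\{x,y\})}\le\frac4{\tau_M^2}\max\{d_M(q_1,x),\,d_M(q_2,y)\}.$$ -/

import Mathlib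

open Set Metric MeasureTheory
open scoped ENNReal Manifold ContDiff

noncomputable section

namespace Reach

/-- The medial axis of a subset `A` of a Euclidean space: the points with at least two nearest
points on `A`. -/
def medialAxis {D : ℕ} (A : Set (EuclideanSpace ℝ (Fin D))) : Set (EuclideanSpace ℝ (Fin D)) :=
  {z | ∃ p ∈ A, ∃ q ∈ A, p ≠ q ∧ dist p z = infDist z A ∧ dist q z = infDist z A}

/-- The reach of `A`: the minimal distance between `A` and its medial axis
(`∞` if the medial axis is empty). -/
def reach {D : ℕ} (A : Set (EuclideanSpace ℝ (Fin D))) : ℝ≥0∞ :=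
  ⨅ z ∈ medialAxis A, infEDist z A

/-- `(q₁, q₂)` is a reach attaining pair of `M`, with axis point `z₀`. -/
def IsReachAttainingPair {D : ℕ} (M : Set (EuclideanSpace ℝ (Fin D))) (q₁ q₂ : M) : Prop :=
  q₁ ≠ q₂ ∧ ∃ z₀ ∈ medialAxis M,
    edist (q₁ : EuclideanSpace ℝ (Fin D)) z₀ ≤ reach M ∧
    edist (q₂ : EuclideanSpace ℝ (Fin D)) z₀ ≤ reach M

/-- A bottleneck: a reach attaining pair of (maximal) size `2 τ_M`. -/
def IsBottleneck {D : ℕ} (M : Set (EuclideanSpace ℝ (Fin D))) (q₁ q₂ : M) : Prop :=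
  IsReachAttainingPair M q₁ q₂ ∧ edist q₁ q₂ = 2 * reach M

/-- The geodesic distance on `M`: the infimum of the lengths `∫ ‖γ'‖` of the `C¹` paths that join
`p` to `q` inside `M` (`∞` if there is none). -/
def geodesicEDist {D : ℕ} (M : Set (EuclideanSpace ℝ (Fin D))) (p q : M) : ℝ≥0∞ :=
  ⨅ (γ : ℝ → EuclideanSpace ℝ (Fin D)) (_ : ContDiffOn ℝ 1 γ (Icc 0 1))
    (_ : MapsTo γ (Icc 0 1) M) (_ : γ 0 = p) (_ : γ 1 = q),
    ∫⁻ t in Icc (0 : ℝ) 1, ‖derivWithin γ (Icc 0 1) t‖ₑ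

/-- The tangent space `T_x M`, as a linear subspace of the ambient Euclidean space: the image of
the differential at `x` of the inclusion of `M`. -/
def tangent {D : ℕ} (d : ℕ) (M : Set (EuclideanSpace ℝ (Fin D)))
    [ChartedSpace (EuclideanSpace ℝ (Fin d)) M] (x : M) :
    Submodule ℝ (EuclideanSpace ℝ (Fin D)) :=
  LinearMap.range (mfderiv (𝓡 d) 𝓘(ℝ, EuclideanSpace ℝ (Fin D))
    (Subtype.val : M → EuclideanSpace ℝ (Fin D)) x).toLinearMap

/-- The plug-in estimator of the reach from a set `X` of points of `M`:
the infimum of `‖y - x‖² / (2 d(y - x, T_x M))` over the pairs `x ≠ y` in `X`. A pair with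
`y - x ∈ T_x M` contributes `∞`. -/
def tauHat {D : ℕ} (d : ℕ) (M : Set (EuclideanSpace ℝ (Fin D)))
    [ChartedSpace (EuclideanSpace ℝ (Fin d)) M] (X : Set M) : ℝ≥0∞ :=
  ⨅ (x ∈ X) (y ∈ X) (_ : x ≠ y),
    ‖(y : EuclideanSpace ℝ (Fin D)) - x‖ₑ ^ 2 /
      (2 * infEDist ((y : EuclideanSpace ℝ (Fin D)) - x)
        (tangent d M x : Set (EuclideanSpace ℝ (Fin D))))

/-- `1 / τ`, as an extended real number, for `τ ∈ [0, ∞]` (so `1 / ∞ = 0` and `1 / 0 = ∞`). -/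
def recip (τ : ℝ≥0∞) : EReal := ((τ⁻¹ : ℝ≥0∞) : EReal)

end Reach

end

open Filter Topology

/-! Everything rests on Federer's inequality `2 τ d(y - x, T_x M) ≤ ‖y - x‖²`
(`Reach.norm_normal_sub_le`). It says that each term of the estimator is at least `τ`, which gives
the lower bound; the middle inequality is monotonicity in the sample. Federer's inequality holds
because, below the reach, the distance to `M` can be increased at unit speed along normals, so balls
of radius close to `τ` tangent to `M` contain no point of `M`.

For the upper bound, put `e = q₂ - q₁`, of norm `2τ`. The axis point is the midpoint of `q₁` and
`q₂`, and a segment to a nearest point is normal, so `e ⊥ T_{q₁} M`. Federer's inequality on triples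
of nearby points also bounds how fast tangent spaces turn: `p ↦ ‖π_{T_p} e‖` is locally
`20/3`-Lipschitz, hence `20/3`-Lipschitz for the geodesic distance. With `m` the maximum of the two
geodesic distances, `‖π_{T_x} e‖ ≤ 20/3 m`, while `y - x` differs from `e` by at most `2m`. So `y -
x` is long and nearly normal at `x`, and `bottleneck_estimate` converts this into the bound. The
rate `20/3` is not optimal, but the final algebra tolerates anything up to `4√3`. -/

/-! ### Local parametrizations of an embedded submanifold -/

theorem Manifold.IsImmersionAt.injective_mfderiv {E E' M : Type*}
    [NormedAddCommGroup E] [NormedSpace ℝ E] [NormedAddCommGroup E'] [NormedSpace ℝ E']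
    [TopologicalSpace M] [ChartedSpace E M] {n : WithTop ℕ∞} [IsManifold 𝓘(ℝ, E) n M]
    (hn : 1 ≤ n) {f : M → E'} {x : M}
    (h : Manifold.IsImmersionAt 𝓘(ℝ, E) 𝓘(ℝ, E') n f x) :
    Function.Injective (mfderiv 𝓘(ℝ, E) 𝓘(ℝ, E') f x) := by
  have : IsManifold 𝓘(ℝ, E) 1 M := IsManifold.of_le hn
  have hdom : h.domChart ∈ IsManifold.maximalAtlas 𝓘(ℝ, E) 1 M :=
    IsManifold.maximalAtlas_subset_of_le hn h.domChart_mem_maximalAtlas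
  have hcod : h.codChart ∈ IsManifold.maximalAtlas 𝓘(ℝ, E') 1 E' :=
    IsManifold.maximalAtlas_subset_of_le hn h.codChart_mem_maximalAtlas
  have hx := h.mem_domChart_source
  have hdomd : h.domChart.MDifferentiable 𝓘(ℝ, E) 𝓘(ℝ, E) :=
    ⟨fun y hy ↦ (mdifferentiableAt_of_mem_maximalAtlas hdom hy).mdifferentiableWithinAt,
     fun y hy ↦ (mdifferentiableAt_symm_of_mem_maximalAtlas hdom hy).mdifferentiableWithinAt⟩
  have hfd : MDifferentiableAt 𝓘(ℝ, E) 𝓘(ℝ, E') f x :=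
    h.contMDiffAt.mdifferentiableAt (by rintro rfl; simp at hn)
  have hcd := mdifferentiableAt_of_mem_maximalAtlas hcod h.mem_codChart_source
  let A : E →L[ℝ] E' := (h.equiv : (E × h.complement) →L[ℝ] E').comp
    (ContinuousLinearMap.inl ℝ E h.complement)
  -- In adapted charts an immersion is the linear injection `A`; the chain rule transfers
  -- injectivity.
  have heq : h.codChart ∘ f =ᶠ[𝓝 x] A ∘ h.domChart := by
    filter_upwards [h.domChart.open_source.mem_nhds hx] with y hy
    have hw := h.writtenInCharts
    have := hw (show h.domChart y ∈ _ by simpa using h.domChart.map_source hy)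
    simpa [hy, A] using this
  have h1 : mfderiv 𝓘(ℝ, E) 𝓘(ℝ, E') (h.codChart ∘ f) x =
      (mfderiv 𝓘(ℝ, E') 𝓘(ℝ, E') h.codChart (f x)).comp (mfderiv 𝓘(ℝ, E) 𝓘(ℝ, E') f x) :=
    mfderiv_comp x hcd hfd
  have h2 : mfderiv 𝓘(ℝ, E) 𝓘(ℝ, E') (A ∘ h.domChart) x =
      A.comp (mfderiv 𝓘(ℝ, E) 𝓘(ℝ, E) h.domChart x) := by
    rw [mfderiv_comp x A.mdifferentiableAt (hdomd.mdifferentiableAt hx)]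
    rw [A.mfderiv_eq]
    rfl
  rw [heq.mfderiv_eq, h2] at h1
  intro v w hvw
  apply hdomd.mfderiv_injective hx
  have hA : Function.Injective A := fun a b hab ↦ by simpa [A] using hab
  apply hA
  have e1 := DFunLike.congr_fun h1 v
  have e2 := DFunLike.congr_fun h1 w
  have e3 : ((mfderiv 𝓘(ℝ, E') 𝓘(ℝ, E') h.codChart (f x)).comp
    (mfderiv 𝓘(ℝ, E) 𝓘(ℝ, E') f x)) v = ((mfderiv 𝓘(ℝ, E') 𝓘(ℝ, E') h.codChart (f x)).comp
    (mfderiv 𝓘(ℝ, E) 𝓘(ℝ, E') f x)) w :=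
    congrArg (mfderiv 𝓘(ℝ, E') 𝓘(ℝ, E') h.codChart (f x)) hvw
  exact e1.trans (e3.trans e2.symm)

/-- All the local geometry used later. Strict differentiability serves the open mapping argument and
the comparison of `f a - f u` with `a - u`. -/
theorem exists_tangent_parametrization {d D : ℕ} {n : WithTop ℕ∞} (hn : 1 ≤ n)
    {M : Set (EuclideanSpace ℝ (Fin D))}
    [ChartedSpace (EuclideanSpace ℝ (Fin d)) M] [IsManifold (𝓡 d) n M]
    (hM : Manifold.IsSmoothEmbedding (𝓡 d) 𝓘(ℝ, EuclideanSpace ℝ (Fin D)) n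
      (Subtype.val : M → EuclideanSpace ℝ (Fin D))) (q : M) :
    ∃ (f : EuclideanSpace ℝ (Fin d) → EuclideanSpace ℝ (Fin D))
      (f' : EuclideanSpace ℝ (Fin d) →L[ℝ] EuclideanSpace ℝ (Fin D)) (u : EuclideanSpace ℝ (Fin d)),
      HasStrictFDerivAt f f' u ∧ Function.Injective f' ∧
      LinearMap.range f'.toLinearMap = Reach.tangent d M q ∧ f u = q ∧
      map f (𝓝 u) = 𝓝[M] (q : EuclideanSpace ℝ (Fin D)) := by
  have hc := hM.contMDiff q
  have hinj := (hM.isImmersion.isImmersionAt q).injective_mfderiv hn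
  have hmd : MDifferentiableAt (𝓡 d) 𝓘(ℝ, EuclideanSpace ℝ (Fin D))
      (Subtype.val : M → EuclideanSpace ℝ (Fin D)) q :=
    hc.mdifferentiableAt (by rintro rfl; simp at hn)
  have hmf : mfderiv (𝓡 d) 𝓘(ℝ, EuclideanSpace ℝ (Fin D))
      (Subtype.val : M → EuclideanSpace ℝ (Fin D)) q =
      fderiv ℝ ((Subtype.val : M → EuclideanSpace ℝ (Fin D)) ∘
        (chartAt (EuclideanSpace ℝ (Fin d)) q).symm) (chartAt (EuclideanSpace ℝ (Fin d)) q q) := by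
    rw [hmd.mfderiv]
    simp [writtenInExtChartAt, extChartAt, fderivWithin_univ]
    rfl
  refine ⟨(Subtype.val : M → EuclideanSpace ℝ (Fin D)) ∘
    (chartAt (EuclideanSpace ℝ (Fin d)) q).symm,
    mfderiv (𝓡 d) 𝓘(ℝ, EuclideanSpace ℝ (Fin D))
      (Subtype.val : M → EuclideanSpace ℝ (Fin D)) q,
    chartAt (EuclideanSpace ℝ (Fin d)) q q, ?_, hinj, rfl, by simp, ?_⟩
  · rw [hmf]
    have := (contMDiffAt_iff.1 hc).2
    simp [extChartAt, contDiffWithinAt_univ] at this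
    exact this.hasStrictFDerivAt (by rintro rfl; simp at hn)
  · rw [← map_map, OpenPartialHomeomorph.symm_map_nhds_eq _ (mem_chart_source _ q), map_nhds_subtype_val]

/-! ### Nearest points and Federer's inequality for compact sets -/

section NearestPoints

variable {E : Type*} [NormedAddCommGroup E] [InnerProductSpace ℝ E]

open scoped RealInnerProductSpace

/-- At a point with a unique nearest point `p` in `A`, the distance to `A` grows at unit speed in
the direction away from `p`. -/
theorem eventually_le_infDist_add_smul {A : Set E} (hA : IsCompact A) {w p : E} (hp : p ∈ A)
    (hpw : dist p w = infDist w A) (hpos : 0 < infDist w A)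
    (huniq : ∀ q ∈ A, dist q w = infDist w A → q = p) {c : ℝ} (hc0 : 0 ≤ c) (hc : c < 1) :
    ∀ᶠ t in 𝓝[>] (0 : ℝ),
      infDist w A + c * t ≤ infDist (w + t • ((infDist w A)⁻¹ • (w - p))) A := by
  set δ := infDist w A with hδ
  set n : E := δ⁻¹ • (w - p) with hn
  have hwp : ‖w - p‖ = δ := by rw [← hpw, dist_comm, dist_eq_norm]
  have hn1 : ‖n‖ = 1 := by
    rw [hn, norm_smul, hwp, Real.norm_of_nonneg (inv_nonneg.2 hpos.le), inv_mul_cancel₀ hpos.ne']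
  -- The half-space excludes `p`, where the inner product is `δ > c * δ`. By uniqueness and
  -- compactness, points of `A` in it stay at distance at least `b > δ`, too far to matter for `t <
  -- (b - δ) / 2`. For the other points, expanding the square suffices.
  obtain ⟨b, hb, hbK⟩ : ∃ b > δ, ∀ q ∈ A, ⟪n, w - q⟫ ≤ c * δ → b ≤ dist q w := by
    have hK : IsCompact (A ∩ {q | ⟪n, w - q⟫ ≤ c * δ}) :=
      hA.inter_right (isClosed_le (by fun_prop) continuous_const)
    rcases (A ∩ {q | ⟪n, w - q⟫ ≤ c * δ}).eq_empty_or_nonempty with h0 | h0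
    · refine ⟨δ + 1, by linarith, fun q hq hq' ↦ ?_⟩
      have : q ∈ A ∩ {q | ⟪n, w - q⟫ ≤ c * δ} := ⟨hq, hq'⟩
      simp [h0] at this
    · obtain ⟨q₀, hq₀, hmin⟩ := hK.exists_isMinOn h0 (f := fun q ↦ dist q w) (by fun_prop)
      refine ⟨dist q₀ w, ?_, fun q hq hq' ↦ hmin ⟨hq, hq'⟩⟩
      refine lt_of_le_of_ne (by rw [dist_comm]; exact infDist_le_dist_of_mem hq₀.1) fun h ↦ ?_
      have h1 := huniq q₀ hq₀.1 h.symm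
      have h2 : ⟪n, w - q₀⟫ ≤ c * δ := hq₀.2
      rw [h1, hn, real_inner_smul_left, real_inner_self_eq_norm_sq, hwp] at h2
      have : δ⁻¹ * δ ^ 2 = δ := by field_simp
      nlinarith
  have hlt : (0 : ℝ) < (b - δ) / 2 := by linarith
  filter_upwards [Ioo_mem_nhdsGT hlt] with t ht
  refine (le_infDist ⟨p, hp⟩).2 fun q hq ↦ ?_
  rcases le_or_gt ⟪n, w - q⟫ (c * δ) with h | h
  · have h1 := hbK q hq h
    have h2 : dist q w ≤ dist (w + t • n) q + t := by
      calc dist q w ≤ dist q (w + t • n) + dist (w + t • n) w := dist_triangle _ _ _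
        _ = _ := by
          rw [dist_comm q, dist_eq_norm (w + t • n) w, add_sub_cancel_left, norm_smul, hn1,
            Real.norm_of_nonneg ht.1.le, mul_one]
    have h3 := ht.2
    nlinarith [ht.1]
  · rw [dist_eq_norm]
    have h1 : δ ≤ ‖w - q‖ := by rw [← dist_eq_norm]; exact infDist_le_dist_of_mem hq
    refine le_of_sq_le_sq ?_ (norm_nonneg _)
    have : w + t • n - q = (w - q) + t • n := by abel
    rw [this, norm_add_sq_real, norm_smul, hn1, real_inner_smul_right, real_inner_comm,
      Real.norm_of_nonneg ht.1.le]
    have h2 : t * (c * δ) ≤ t * ⟪n, w - q⟫ := mul_le_mul_of_nonneg_left h.le ht.1.le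
    have h3 : c ^ 2 * t ^ 2 ≤ t ^ 2 := by
      have : c ^ 2 ≤ 1 := by nlinarith
      nlinarith [sq_nonneg t]
    nlinarith

variable [ProperSpace E]

/-- If every point closer than `τ` to `A` has a unique nearest point, the distance to `A` can be
increased by `h` on a ball of radius `h`. -/
theorem exists_infDist_add_le {A : Set E} (hA : IsCompact A) (hA0 : A.Nonempty) {τ : ℝ}
    (hτ : ∀ w, infDist w A < τ → ∀ p ∈ A, ∀ q ∈ A,
      dist p w = infDist w A → dist q w = infDist w A → p = q)
    {z : E} (hz : 0 < infDist z A) {h : ℝ} (hh : 0 ≤ h) (hzτ : infDist z A + h < τ) :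
    ∃ w ∈ closedBall z h, infDist z A + h ≤ infDist w A := by
  -- A maximizer of `infDist w A - c * dist w z` lies on the sphere of radius `h`: from an interior
  -- one, moving away from the nearest point gains at rate `(1 + c) / 2 > c`.
  have key : ∀ c : ℝ, 0 ≤ c → c < 1 → ∃ w ∈ closedBall z h, infDist z A + c * h ≤ infDist w A := by
    intro c hc0 hc
    obtain ⟨w, hw, hmax⟩ := (isCompact_closedBall z h).exists_isMaxOn ⟨z, by simpa⟩
      (f := fun w ↦ infDist w A - c * dist w z)
      ((continuous_infDist_pt A).sub (by fun_prop)).continuousOn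
    have hgz : infDist z A ≤ infDist w A - c * dist w z := by
      have := hmax (show z ∈ closedBall z h by simpa)
      simpa using this
    refine ⟨w, hw, ?_⟩
    rcases (mem_closedBall.1 hw).eq_or_lt with h1 | h1
    · rw [← h1]; linarith
    exfalso
    have hd : 0 ≤ c * dist w z := by positivity
    have hwpos : 0 < infDist w A := by linarith
    have hwτ : infDist w A < τ := by
      have := infDist_le_infDist_add_dist (s := A) (x := w) (y := z)
      linarith
    obtain ⟨p, hp, hpw⟩ := hA.exists_infDist_eq_dist hA0 w
    have hpw' : dist p w = infDist w A := by rw [hpw, dist_comm]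
    have hev := eventually_le_infDist_add_smul hA hp hpw' hwpos
      (fun q hq hqw ↦ hτ w hwτ q hq p hp hqw hpw') (c := (1 + c) / 2) (by linarith) (by linarith)
    obtain ⟨t, ht, ht'⟩ := (hev.and (Ioo_mem_nhdsGT (sub_pos.2 h1))).exists
    set w' := w + t • ((infDist w A)⁻¹ • (w - p)) with hw'
    have hdist : dist w' w = t := by
      rw [dist_eq_norm, hw', add_sub_cancel_left, norm_smul, norm_smul, ← dist_eq_norm, ← hpw,
        Real.norm_of_nonneg ht'.1.le, Real.norm_of_nonneg (inv_nonneg.2 hwpos.le),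
        inv_mul_cancel₀ hwpos.ne', mul_one]
    have htri : dist w' z ≤ t + dist w z := by
      rw [← hdist]; exact dist_triangle _ _ _
    have hle := hmax (show w' ∈ closedBall z h from mem_closedBall.2 (by linarith [ht'.2]))
    simp only [mem_ofPred_eq] at hle
    have : c * dist w' z ≤ c * (t + dist w z) := mul_le_mul_of_nonneg_left htri hc0
    nlinarith [ht'.1]
  -- The points found for `c < 1` vary with `c`; a maximizer of the distance dominates them all, so
  -- `c → 1` is harmless.
  obtain ⟨w, hw, hmax⟩ := (isCompact_closedBall z h).exists_isMaxOn ⟨z, by simpa⟩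
    (continuous_infDist_pt A).continuousOn
  refine ⟨w, hw, ?_⟩
  have hlim : Tendsto (fun c : ℝ ↦ infDist z A + c * h) (𝓝[<] 1) (𝓝 (infDist z A + 1 * h)) := by
    apply Tendsto.mono_left _ nhdsWithin_le_nhds
    exact Continuous.tendsto (by fun_prop) _
  rw [one_mul] at hlim
  refine le_of_tendsto hlim ?_
  filter_upwards [Ioo_mem_nhdsLT (zero_lt_one' ℝ)] with c hc
  obtain ⟨w', hw', hle⟩ := key c hc.1.le hc.2
  exact hle.trans (hmax hw')

/-- Federer's inequality in the direction of a point `z` that projects to `p`. -/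
theorem inner_sub_le_of_dist_eq_infDist {A : Set E} (hA : IsCompact A) {τ : ℝ}
    (hτ : ∀ w, infDist w A < τ → ∀ p ∈ A, ∀ q ∈ A,
      dist p w = infDist w A → dist q w = infDist w A → p = q)
    {z p : E} (hp : p ∈ A) (hzp : dist p z = infDist z A) (hz : 0 < infDist z A)
    (hzτ : infDist z A < τ) {y : E} (hy : y ∈ A) :
    2 * τ * ⟪z - p, y - p⟫ ≤ ‖z - p‖ * ‖y - p‖ ^ 2 := by
  set s := infDist z A with hs
  have hzp' : ‖z - p‖ = s := by rw [← hzp, dist_comm, dist_eq_norm]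
  have key : ∀ t ∈ Ioo s τ, 2 * t * ⟪z - p, y - p⟫ ≤ s * ‖y - p‖ ^ 2 := by
    intro t ht
    obtain ⟨w, hw, hle⟩ := exists_infDist_add_le hA ⟨p, hp⟩ hτ hz (h := t - s)
      (by linarith [ht.1]) (by linarith [ht.2])
    rw [← hs, add_sub_cancel] at hle
    rw [mem_closedBall, dist_eq_norm] at hw
    have h1 : t ≤ ‖(w - z) + (z - p)‖ := by
      rw [sub_add_sub_cancel, ← dist_eq_norm]
      exact hle.trans (infDist_le_dist_of_mem hp)
    have h2 := norm_add_le (w - z) (z - p)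
    -- Equality in the triangle inequality forces `w = p + (t / s) • (z - p)`. The open ball of
    -- radius `t` about `w` misses `A`; expanding `t ≤ ‖w - y‖` gives the claim.
    have h3 : ‖w - z‖ = t - s := by linarith
    have h4 : SameRay ℝ (w - z) (z - p) := sameRay_iff_norm_add.2 (by linarith)
    rw [sameRay_iff_norm_smul_eq, h3, hzp'] at h4
    have h5 : s • (w - p) = t • (z - p) := by
      have : w - p = (w - z) + (z - p) := by abel
      rw [this, smul_add, ← h4, ← add_smul]
      congr 1
      ring
    have h6 : t ≤ ‖w - y‖ := by
      rw [← dist_eq_norm]; exact hle.trans (infDist_le_dist_of_mem hy)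
    have h7 : s • (w - y) = t • (z - p) - s • (y - p) := by
      rw [← h5, ← smul_sub]; congr 1; abel
    have h8 : ‖s • (w - y)‖ ^ 2 = t ^ 2 * s ^ 2 - 2 * (t * s * ⟪z - p, y - p⟫) +
        s ^ 2 * ‖y - p‖ ^ 2 := by
      rw [h7, norm_sub_sq_real, norm_smul, norm_smul, hzp', real_inner_smul_left,
        real_inner_smul_right, mul_pow, mul_pow, Real.norm_eq_abs, Real.norm_eq_abs, sq_abs, sq_abs]
      ring
    have h9 : s ^ 2 * t ^ 2 ≤ ‖s • (w - y)‖ ^ 2 := by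
      rw [norm_smul, Real.norm_of_nonneg hz.le, mul_pow]
      have := ht.1
      gcongr
      linarith
    have h10 : s * (2 * t * ⟪z - p, y - p⟫) ≤ s * (s * ‖y - p‖ ^ 2) := by nlinarith
    exact le_of_mul_le_mul_left h10 hz
  rw [hzp']
  have hlim : Tendsto (fun t : ℝ ↦ 2 * t * ⟪z - p, y - p⟫) (𝓝[<] τ)
      (𝓝 (2 * τ * ⟪z - p, y - p⟫)) := by
    apply Tendsto.mono_left _ nhdsWithin_le_nhds
    exact Continuous.tendsto (by fun_prop) _
  refine le_of_tendsto hlim ?_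
  filter_upwards [Ioo_mem_nhdsLT hzτ] with t ht using key t ht

/-- Federer's inequality for a vector that is normal to `A` to first order. -/
theorem inner_sub_le_of_isLittleO {A : Set E} (hA : IsCompact A) {τ : ℝ} (hτ0 : 0 < τ)
    (hτ : ∀ w, infDist w A < τ → ∀ p ∈ A, ∀ q ∈ A,
      dist p w = infDist w A → dist q w = infDist w A → p = q)
    {x v : E} (hx : x ∈ A) (hv : ‖v‖ = 1)
    (hvo : (fun p ↦ ⟪v, p - x⟫) =o[𝓝[A] x] (fun p ↦ p - x)) {y : E} (hy : y ∈ A) :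
    2 * τ * ⟪v, y - x⟫ ≤ ‖y - x‖ ^ 2 := by
  have hproj : ∀ s : ℝ, ∃ p ∈ A, infDist (x + s • v) A = dist (x + s • v) p :=
    fun s ↦ hA.exists_infDist_eq_dist ⟨x, hx⟩ _
  choose p hpA hp using hproj
  have hps : ∀ s : ℝ, 0 < s → ‖s • v - (p s - x)‖ ≤ s := by
    intro s hs
    have h1 : s • v - (p s - x) = x + s • v - p s := by abel
    rw [h1, ← dist_eq_norm, ← hp s]
    refine (infDist_le_dist_of_mem hx).trans ?_
    rw [dist_eq_norm, add_sub_cancel_left, norm_smul, hv, Real.norm_of_nonneg hs.le, mul_one]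
  have hsq : ∀ s : ℝ, 0 < s → ‖p s - x‖ ^ 2 ≤ 2 * s * ⟪v, p s - x⟫ := by
    intro s hs
    have h1 := pow_le_pow_left₀ (norm_nonneg _) (hps s hs) 2
    rw [norm_sub_sq_real, norm_smul, hv, real_inner_smul_left, Real.norm_of_nonneg hs.le] at h1
    linarith
  have h2s : ∀ s : ℝ, 0 < s → ‖p s - x‖ ≤ 2 * s := by
    intro s hs
    have h1 := norm_sub_norm_le (p s - x) (s • v)
    rw [norm_sub_rev (p s - x) (s • v), norm_smul, hv, Real.norm_of_nonneg hs.le] at h1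
    linarith [hps s hs]
  have hpx : Tendsto p (𝓝[>] 0) (𝓝[A] x) := by
    refine tendsto_nhdsWithin_iff.2 ⟨?_, Eventually.of_forall hpA⟩
    rw [tendsto_iff_norm_sub_tendsto_zero]
    have hlim : Tendsto (fun s : ℝ ↦ 2 * s) (𝓝[>] 0) (𝓝 0) := by
      apply Tendsto.mono_left _ nhdsWithin_le_nhds
      have : Continuous (fun s : ℝ ↦ 2 * s) := by fun_prop
      simpa using this.tendsto 0
    refine squeeze_zero' (Eventually.of_forall fun _ ↦ norm_nonneg _) ?_ hlim
    filter_upwards [self_mem_nhdsWithin] with s hs using h2s s hs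
  -- By `hsq`, `‖p s - x‖²` is at most `2s` times `o(‖p s - x‖)`, so `p s - x = o(s)`. The
  -- directions from `p s` to `x + s • v` thus tend to `v`, and the inequality at `p s` passes to
  -- the limit.
  have hρ : Tendsto (fun s : ℝ ↦ s⁻¹ • (p s - x)) (𝓝[>] 0) (𝓝 0) := by
    rw [NormedAddGroup.tendsto_nhds_zero]
    intro ε hε
    have h1 := (hvo.comp_tendsto hpx).def (show 0 < ε / 4 by positivity)
    filter_upwards [h1, self_mem_nhdsWithin] with s hs hs0
    have hs0' : (0 : ℝ) < s := hs0
    simp only [Function.comp_apply] at hs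
    have h2 : ‖p s - x‖ ^ 2 ≤ 2 * s * (ε / 4 * ‖p s - x‖) :=
      (hsq s hs0).trans (mul_le_mul_of_nonneg_left ((Real.le_norm_self _).trans hs) (by positivity))
    have h3 : ‖p s - x‖ ≤ s * (ε / 2) := by
      rcases (norm_nonneg (p s - x)).eq_or_lt with h | h
      · rw [← h]; positivity
      · nlinarith
    rw [norm_smul, Real.norm_of_nonneg (inv_nonneg.2 hs0'.le), inv_mul_lt_iff₀ hs0']
    have := mul_pos hs0' hε
    linarith
  have hu : Tendsto (fun s : ℝ ↦ v - s⁻¹ • (p s - x)) (𝓝[>] 0) (𝓝 v) := by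
    simpa using tendsto_const_nhds.sub hρ
  have hev : ∀ᶠ s in 𝓝[>] (0 : ℝ), 2 * τ * ⟪v - s⁻¹ • (p s - x), y - p s⟫ ≤
      ‖v - s⁻¹ • (p s - x)‖ * ‖y - p s‖ ^ 2 := by
    have hne : ∀ᶠ s in 𝓝[>] (0 : ℝ), v - s⁻¹ • (p s - x) ≠ 0 :=
      hu.eventually_ne (by rintro rfl; simp at hv)
    filter_upwards [hne, Ioo_mem_nhdsGT hτ0] with s hs hs'
    have h1 : x + s • v - p s = s • (v - s⁻¹ • (p s - x)) := by
      rw [smul_sub, smul_inv_smul₀ hs'.1.ne']; abel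
    have h2 : infDist (x + s • v) A = s * ‖v - s⁻¹ • (p s - x)‖ := by
      rw [hp, dist_eq_norm, h1, norm_smul, Real.norm_of_nonneg hs'.1.le]
    have h3 : infDist (x + s • v) A ≤ s := by
      rw [hp, dist_eq_norm]
      have h1 : s • v - (p s - x) = x + s • v - p s := by abel
      rw [← h1]; exact hps s hs'.1
    have h4 := inner_sub_le_of_dist_eq_infDist hA hτ (hpA s) (by rw [hp, dist_comm])
      (h2 ▸ mul_pos hs'.1 (norm_pos_iff.2 hs)) (h3.trans_lt hs'.2) hy
    rw [h1, real_inner_smul_left, norm_smul, Real.norm_of_nonneg hs'.1.le] at h4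
    refine le_of_mul_le_mul_left ?_ hs'.1
    linarith
  have hyp : Tendsto (fun s ↦ y - p s) (𝓝[>] 0) (𝓝 (y - x)) :=
    tendsto_const_nhds.sub (hpx.mono_right nhdsWithin_le_nhds)
  have := le_of_tendsto_of_tendsto ((hu.inner hyp).const_mul (2 * τ))
    (hu.norm.mul (hyp.norm.pow 2)) hev
  simpa [hv] using this

end NearestPoints

/-! ### From local to geodesic Lipschitz bounds -/

/-- A function on `M` that is pointwise `K`-Lipschitz for the ambient distance is `K`-Lipschitz
for the geodesic distance. -/
theorem edist_le_mul_geodesicEDist {D : ℕ} {M : Set (EuclideanSpace ℝ (Fin D))}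
    {Y : Type*} [PseudoMetricSpace Y] {s : M → Y} {K : NNReal} (hK0 : K ≠ 0)
    (hs : ∀ q : M, ∀ᶠ p in 𝓝 q, dist (s q) (s p) ≤ K * dist q p) (p q : M) :
    edist (s p) (s q) ≤ K * Reach.geodesicEDist M p q := by
  have hscont : Continuous s := by
    rw [continuous_iff_continuousAt]
    intro q
    rw [ContinuousAt, tendsto_iff_dist_tendsto_zero]
    have hlim : Tendsto (fun p ↦ K * dist q p) (𝓝 q) (𝓝 0) := by
      have : Continuous (fun p ↦ K * dist q p) := by fun_prop
      simpa using this.tendsto q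
    refine squeeze_zero' (Eventually.of_forall fun _ ↦ dist_nonneg) ?_ hlim
    filter_upwards [hs q] with p hp
    rwa [dist_comm]
  rw [Reach.geodesicEDist]
  simp only [ENNReal.mul_iInf_of_ne (ENNReal.coe_ne_zero.2 hK0) ENNReal.coe_ne_top]
  refine le_iInf fun γ ↦ le_iInf fun hγ ↦ le_iInf fun hmaps ↦ le_iInf fun h0 ↦ le_iInf fun h1 ↦ ?_
  set g : ℝ → ℝ := fun t ↦ ‖derivWithin γ (Icc 0 1) t‖ with hg
  have hdc : ContinuousOn (derivWithin γ (Icc 0 1)) (Icc 0 1) :=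
    hγ.continuousOn_derivWithin (uniqueDiffOn_Icc one_pos) le_rfl
  have hgc : ContinuousOn g (Icc 0 1) := hdc.norm
  have hgi : ∀ a ∈ Icc (0 : ℝ) 1, ∀ b ∈ Icc (0 : ℝ) 1, IntervalIntegrable g volume a b :=
    fun a ha b hb ↦ (hgc.mono (uIcc_subset_Icc ha hb)).intervalIntegrable
  set ℓ : ℝ → ℝ := fun t ↦ ∫ x in (0 : ℝ)..t, g x with hℓ
  have hℓc : ContinuousOn ℓ (Icc 0 1) := by
    have := intervalIntegral.continuousOn_primitive_interval' (hgi 0 (by simp) 1 (by simp))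
      (a := 0) (by simp)
    simpa using this
  have hdist : ∀ a ∈ Icc (0 : ℝ) 1, ∀ b ∈ Icc (0 : ℝ) 1, a ≤ b → dist (γ a) (γ b) ≤ ℓ b - ℓ a := by
    intro a ha b hb hab
    have h2 : ContDiffOn ℝ 1 γ (Icc a b) := hγ.mono (Icc_subset_Icc ha.1 hb.2)
    rw [dist_comm, dist_eq_norm, ← intervalIntegral.integral_deriv_of_contDiffOn_Icc h2 hab,
      intervalIntegral.integral_interval_sub_left (hgi _ (by simp) _ hb) (hgi _ (by simp) _ ha)]
    refine (intervalIntegral.norm_integral_le_integral_norm hab).trans_eq ?_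
    rw [intervalIntegral.integral_of_le hab, intervalIntegral.integral_of_le hab]
    apply integral_congr_ae
    rw [← restrict_Ioo_eq_restrict_Ioc]
    filter_upwards [self_mem_ae_restrict measurableSet_Ioo] with x hx
    rw [hg]
    dsimp only
    rw [derivWithin_of_mem_nhds (Icc_mem_nhds (ha.1.trans_lt hx.1) (hx.2.trans_le hb.2))]
  -- Extending `γ` by constants makes the path continuous on all of `ℝ`.
  set Γ : ℝ → M := fun t ↦ ⟨γ (projIcc 0 1 zero_le_one t), hmaps (projIcc 0 1 zero_le_one t).2⟩
    with hΓ
  have hΓγ : ∀ t ∈ Icc (0 : ℝ) 1, (Γ t : EuclideanSpace ℝ (Fin D)) = γ t := fun t ht ↦ by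
    simp [hΓ, projIcc_of_mem zero_le_one ht]
  have hΓc : Continuous Γ := by
    refine Continuous.subtype_mk ?_ _
    exact hγ.continuousOn.comp_continuous (continuous_subtype_val.comp continuous_projIcc)
      fun t ↦ (projIcc 0 1 zero_le_one t).2
  -- Continuous induction: the set is closed, contains `0`, and the local bound extends it to the
  -- right.
  have hsub : Icc (0 : ℝ) 1 ⊆ {t | dist (s (Γ 0)) (s (Γ t)) ≤ K * ℓ t} := by
    refine IsClosed.Icc_subset_of_forall_mem_nhdsWithin ?_ (by simp [hℓ]) ?_
    · have := isClosed_Icc.isClosed_le (s := Icc (0 : ℝ) 1)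
        (f := fun t ↦ dist (s (Γ 0)) (s (Γ t))) (g := fun t ↦ K * ℓ t) (by fun_prop)
        (hℓc.const_mul _)
      convert this using 1
      ext t
      exact and_comm
    · rintro t ⟨ht, ht0, ht1⟩
      have hev := (hΓc.tendsto t).eventually (hs (Γ t))
      filter_upwards [nhdsWithin_le_nhds hev, Ioo_mem_nhdsGT ht1] with t' ht' htt'
      have htI : t ∈ Icc (0 : ℝ) 1 := ⟨ht0, ht1.le⟩
      have htI' : t' ∈ Icc (0 : ℝ) 1 := ⟨ht0.trans htt'.1.le, htt'.2.le⟩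
      have h2 := hdist t htI t' htI' htt'.1.le
      rw [← hΓγ t htI, ← hΓγ t' htI'] at h2
      have h3 := dist_triangle (s (Γ 0)) (s (Γ t)) (s (Γ t'))
      have h4 : (K : ℝ) * dist (Γ t) (Γ t') ≤ K * (ℓ t' - ℓ t) :=
        mul_le_mul_of_nonneg_left h2 K.2
      have h5 : dist (s (Γ 0)) (s (Γ t)) ≤ K * ℓ t := ht
      show dist (s (Γ 0)) (s (Γ t')) ≤ K * ℓ t'
      linarith
  have hfin : dist (s (Γ 0)) (s (Γ 1)) ≤ K * ℓ 1 := hsub (by simp)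
  have hΓ0 : Γ 0 = p := Subtype.ext ((hΓγ 0 (by simp)).trans h0)
  have hΓ1 : Γ 1 = q := Subtype.ext ((hΓγ 1 (by simp)).trans h1)
  rw [hΓ0, hΓ1] at hfin
  rw [edist_dist]
  refine (ENNReal.ofReal_le_ofReal hfin).trans_eq ?_
  rw [ENNReal.ofReal_mul K.coe_nonneg, ENNReal.ofReal_coe_nnreal]
  congr 1
  rw [hℓ]
  dsimp only
  rw [intervalIntegral.integral_of_le zero_le_one, restrict_Ioc_eq_restrict_Icc,
    ofReal_integral_eq_lintegral_ofReal]
  · simp [hg]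
  · exact hgc.integrableOn_Icc
  · exact Eventually.of_forall fun _ ↦ norm_nonneg _

/-! ### Tangent spaces and Federer's inequality on `M` -/

section Tangent

open scoped RealInnerProductSpace

variable {d D : ℕ} {n : WithTop ℕ∞} {M : Set (EuclideanSpace ℝ (Fin D))}
  [ChartedSpace (EuclideanSpace ℝ (Fin d)) M] [IsManifold (𝓡 d) n M]

theorem Reach.finrank_tangent (hn : 1 ≤ n)
    (hM : Manifold.IsSmoothEmbedding (𝓡 d) 𝓘(ℝ, EuclideanSpace ℝ (Fin D)) n
      (Subtype.val : M → EuclideanSpace ℝ (Fin D))) (q : M) :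
    Module.finrank ℝ (Reach.tangent d M q) = d := by
  obtain ⟨f, f', u, -, hinj, hran, -, -⟩ := exists_tangent_parametrization hn hM q
  rw [← hran, LinearMap.finrank_range_of_inj hinj, finrank_euclideanSpace_fin]

/-- A normal vector annihilates the linear part of the parametrization; injectivity of `f'` turns an
error `o(a - u)` into `o(f a - f u)`. -/
theorem Reach.inner_sub_isLittleO (hn : 1 ≤ n)
    (hM : Manifold.IsSmoothEmbedding (𝓡 d) 𝓘(ℝ, EuclideanSpace ℝ (Fin D)) n
      (Subtype.val : M → EuclideanSpace ℝ (Fin D))) (q : M) {v : EuclideanSpace ℝ (Fin D)}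
    (hv : v ∈ (Reach.tangent d M q)ᗮ) :
    (fun p ↦ ⟪v, p - q⟫) =o[𝓝[M] (q : EuclideanSpace ℝ (Fin D))] (fun p ↦ p - q) := by
  obtain ⟨f, f', u, hf, hinj, hran, hfu, hmap⟩ := exists_tangent_parametrization hn hM q
  rw [← hmap, Asymptotics.isLittleO_map, ← hfu]
  obtain ⟨C, -, hC⟩ := LinearMap.exists_antilipschitzWith f'.toLinearMap (LinearMap.ker_eq_bot.2 hinj)
  have h1 : (fun a ↦ a - u) =O[𝓝 u] fun a ↦ f a - f u := by
    have hind := (hC.isUniformInducing f'.uniformContinuous).isInducing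
    exact (HasFDerivAtFilter.isTheta_sub hf hind).isBigO_symm.comp_tendsto
      (k := fun a ↦ (a, u)) (tendsto_id.prodMk_nhds tendsto_const_nhds)
  have h2 : (fun a ↦ f a - f u - f' (a - u)) =o[𝓝 u] fun a ↦ a - u := hf.hasFDerivAt.isLittleO
  refine Asymptotics.IsLittleO.trans_isBigO (Asymptotics.IsBigO.trans_isLittleO ?_ h2) h1
  refine Asymptotics.IsBigO.of_bound ‖v‖ (Eventually.of_forall fun a ↦ ?_)
  have h3 : ⟪v, f' (a - u)⟫ = 0 :=
    Submodule.inner_left_of_mem_orthogonal (hran ▸ LinearMap.mem_range_self _ (a - u)) hv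
  have h4 : ⟪v, f a - f u⟫ = ⟪v, f a - f u - f' (a - u)⟫ := by
    rw [inner_sub_right v (f a - f u), h3, sub_zero]
  simp only [Function.comp_apply]
  rw [h4]
  exact norm_inner_le_norm _ _

/-- The parametrization followed by projection has derivative onto `T_q M`, hence is open at `u`. -/
theorem Reach.nhds_le_map_orthogonalProjection (hn : 1 ≤ n)
    (hM : Manifold.IsSmoothEmbedding (𝓡 d) 𝓘(ℝ, EuclideanSpace ℝ (Fin D)) n
      (Subtype.val : M → EuclideanSpace ℝ (Fin D))) (q : M) :
    𝓝 0 ≤ map (fun p ↦ (Reach.tangent d M q).orthogonalProjectionOnto (p - q))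
      (𝓝[M] (q : EuclideanSpace ℝ (Fin D))) := by
  obtain ⟨f, f', u, hf, hinj, hran, hfu, hmap⟩ := exists_tangent_parametrization hn hM q
  have h1 := ((Reach.tangent d M q).orthogonalProjectionOnto.hasStrictFDerivAt
    (x := f u - q)).comp u (hf.sub_const (q : EuclideanSpace ℝ (Fin D)))
  have h2 := h1.map_nhds_eq_of_surj (by
    rw [LinearMap.range_eq_top]
    intro w
    obtain ⟨a, ha⟩ : (w : EuclideanSpace ℝ (Fin D)) ∈ LinearMap.range f'.toLinearMap := by
      rw [hran]; exact w.2
    refine ⟨a, ?_⟩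
    show (Reach.tangent d M q).orthogonalProjectionOnto (f' a) = w
    have ha' : f' a = w := ha
    rw [ha', Submodule.orthogonalProjectionOnto_mem_subspace_eq_self])
  rw [← hmap, map_map]
  simp only [Function.comp_def, hfu, sub_self, map_zero] at h2 ⊢
  exact h2.ge

omit [ChartedSpace (EuclideanSpace ℝ (Fin d)) M] in
theorem Reach.eq_of_infDist_lt_reach {w p q : EuclideanSpace ℝ (Fin D)}
    (hw : infDist w M < (Reach.reach M).toReal) (hp : p ∈ M) (hq : q ∈ M)
    (hpw : dist p w = infDist w M) (hqw : dist q w = infDist w M) : p = q := by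
  by_contra hne
  have h1 : Reach.reach M ≤ infEDist w M := iInf₂_le w ⟨p, hp, q, hq, hne, hpw, hqw⟩
  have h2 := ENNReal.toReal_mono (infEDist_ne_top ⟨p, hp⟩) h1
  exact absurd hw (not_lt.2 h2)

/-- Federer's inequality. -/
theorem Reach.norm_normal_sub_le (hn : 1 ≤ n)
    (hM : Manifold.IsSmoothEmbedding (𝓡 d) 𝓘(ℝ, EuclideanSpace ℝ (Fin D)) n
      (Subtype.val : M → EuclideanSpace ℝ (Fin D))) (hMc : IsCompact M)
    (hτ : 0 < (Reach.reach M).toReal) (x y : M) :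
    2 * (Reach.reach M).toReal *
      ‖(Reach.tangent d M x)ᗮ.starProjection ((y : EuclideanSpace ℝ (Fin D)) - x)‖ ≤
      ‖(y : EuclideanSpace ℝ (Fin D)) - x‖ ^ 2 := by
  set v := (Reach.tangent d M x)ᗮ.starProjection ((y : EuclideanSpace ℝ (Fin D)) - x) with hv
  rcases eq_or_ne v 0 with h0 | h0
  · rw [h0, norm_zero, mul_zero]; positivity
  have hvmem : v ∈ (Reach.tangent d M x)ᗮ := Submodule.starProjection_apply_mem _ _
  have h1 := inner_sub_le_of_isLittleO hMc hτ
    (fun w hw p hp q hq hpw hqw ↦ Reach.eq_of_infDist_lt_reach hw hp hq hpw hqw) x.2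
    (v := ‖v‖⁻¹ • v) (norm_smul_inv_norm h0)
    (Reach.inner_sub_isLittleO hn hM x (Submodule.smul_mem _ _ hvmem)) y.2
  have h2 : ⟪v, (y : EuclideanSpace ℝ (Fin D)) - x⟫ = ‖v‖ ^ 2 := by
    have := Submodule.re_inner_starProjection_eq_normSq (Reach.tangent d M x)ᗮ ((y : EuclideanSpace ℝ (Fin D)) - x)
    exact this
  rw [real_inner_smul_left, h2] at h1
  have h3 : ‖v‖⁻¹ * ‖v‖ ^ 2 = ‖v‖ := by
    have := norm_ne_zero_iff.2 h0
    field_simp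
  rwa [h3] at h1

end Tangent

/-! ### Angles between subspaces -/

section Angle

open scoped RealInnerProductSpace

variable {E : Type*} [NormedAddCommGroup E] [InnerProductSpace ℝ E]

theorem Submodule.norm_starProjection_orthogonal_le_norm_sub (T : Submodule ℝ E)
    [T.HasOrthogonalProjection] (v : E) {w : E} (hw : w ∈ T) :
    ‖Tᗮ.starProjection v‖ ≤ ‖v - w‖ := by
  have h1 : Tᗮ.starProjection (v - w) = Tᗮ.starProjection v := by
    rw [map_sub, Submodule.starProjection_orthogonal_apply_eq_zero hw, sub_zero]
  rw [← h1]
  exact Submodule.norm_starProjection_apply_le _ _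

theorem Submodule.infEDist_eq_norm_starProjection_orthogonal (T : Submodule ℝ E)
    [T.HasOrthogonalProjection] (v : E) :
    infEDist v (T : Set E) = ENNReal.ofReal ‖Tᗮ.starProjection v‖ := by
  apply le_antisymm
  · refine (infEDist_le_edist_of_mem (Submodule.starProjection_apply_mem T v)).trans_eq ?_
    rw [Submodule.starProjection_orthogonal_val, edist_dist, dist_eq_norm]
  · refine le_infEDist.2 fun w hw ↦ ?_
    rw [edist_dist, dist_eq_norm]
    exact ENNReal.ofReal_le_ofReal (T.norm_starProjection_orthogonal_le_norm_sub v hw)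

/-- If `S` is close to `T` and they have the same dimension, then `T` is close to `S`. -/
theorem Submodule.norm_starProjection_orthogonal_le_of_finrank_eq {S T : Submodule ℝ E}
    [FiniteDimensional ℝ S] [FiniteDimensional ℝ T]
    (hST : Module.finrank ℝ S = Module.finrank ℝ T) {c : ℝ} (hc0 : 0 ≤ c) (hc : c < 1)
    (h : ∀ u ∈ S, ‖Tᗮ.starProjection u‖ ≤ c * ‖u‖) {u : E} (hu : u ∈ T) :
    ‖Sᗮ.starProjection u‖ ≤ c / (1 - c) * ‖u‖ := by
  let F : S →ₗ[ℝ] T := T.orthogonalProjectionOnto.toLinearMap ∘ₗ S.subtype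
  have hdecomp : ∀ w : E, w = T.starProjection w + Tᗮ.starProjection w := fun w ↦
    (Submodule.starProjection_add_starProjection_orthogonal (K := T) w).symm
  -- As `c < 1`, no nonzero vector of `S` is orthogonal to `T`. Equal dimensions then make every `u
  -- ∈ T` the projection of some `w ∈ S`.
  have hinj : Function.Injective F := by
    rw [← LinearMap.ker_eq_bot, LinearMap.ker_eq_bot']
    intro w hw
    have h1 : T.starProjection (w : E) = 0 := by
      rw [Submodule.starProjection_apply]; exact congrArg Subtype.val hw
    have h2 := hdecomp w
    rw [h1, zero_add] at h2
    have h3 := h w w.2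
    rw [← h2] at h3
    have h4 : ‖(w : E)‖ = 0 := by nlinarith [norm_nonneg (w : E)]
    exact Subtype.ext (norm_eq_zero.1 h4)
  obtain ⟨w, hw⟩ := (LinearMap.injective_iff_surjective_of_finrank_eq_finrank hST).1 hinj ⟨u, hu⟩
  have h1 : T.starProjection (w : E) = u := by
    rw [Submodule.starProjection_apply]; exact congrArg Subtype.val hw
  have h2 := hdecomp w
  rw [h1] at h2
  have h3 : ‖u - w‖ ≤ c * ‖(w : E)‖ := by
    have : u - w = -(Tᗮ.starProjection (w : E)) := by
      nth_rw 1 [h2]; abel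
    rw [this, norm_neg]
    exact h w w.2
  have h4 : ‖(w : E)‖ ≤ ‖u‖ + ‖u - w‖ := by
    have := norm_sub_le u (u - w)
    rwa [sub_sub_cancel] at this
  have h5 : ‖(w : E)‖ ≤ ‖u‖ / (1 - c) := by
    rw [le_div_iff₀ (by linarith)]; nlinarith
  calc ‖Sᗮ.starProjection u‖ ≤ ‖u - w‖ := S.norm_starProjection_orthogonal_le_norm_sub u w.2
    _ ≤ c * ‖(w : E)‖ := h3
    _ ≤ c * (‖u‖ / (1 - c)) := mul_le_mul_of_nonneg_left h5 hc0
    _ = _ := by ring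

theorem Submodule.norm_starProjection_le_add (S T : Submodule ℝ E)
    [S.HasOrthogonalProjection] [T.HasOrthogonalProjection] {c : ℝ} (hc : 0 ≤ c)
    (h : ∀ u ∈ S, ‖Tᗮ.starProjection u‖ ≤ c * ‖u‖) (e : E) :
    ‖S.starProjection e‖ ≤ ‖T.starProjection e‖ + c * ‖e‖ := by
  set u := S.starProjection e with hu
  rcases eq_or_ne u 0 with h0 | h0
  · rw [h0, norm_zero]
    positivity
  have hpos : 0 < ‖u‖ := norm_pos_iff.2 h0
  have h1 : ⟪u, e⟫ = ‖u‖ ^ 2 := Submodule.re_inner_starProjection_eq_normSq S e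
  have h2 : ⟪u, e⟫ = ⟪u, T.starProjection e⟫ + ⟪Tᗮ.starProjection u, e⟫ := by
    nth_rw 1 [← Submodule.starProjection_add_starProjection_orthogonal (K := T) u]
    rw [inner_add_left, Submodule.inner_starProjection_left_eq_right]
  have h3 := real_inner_le_norm u (T.starProjection e)
  have h4 := real_inner_le_norm (Tᗮ.starProjection u) e
  have h5 := mul_le_mul_of_nonneg_right (h u (Submodule.starProjection_apply_mem _ _))
    (norm_nonneg e)
  refine le_of_mul_le_mul_left ?_ hpos
  nlinarith

end Angle

/-! ### Rotation speed of the tangent spaces -/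

section LocalAngle

open scoped RealInnerProductSpace

variable {E : Type*} [NormedAddCommGroup E] [InnerProductSpace ℝ E] [FiniteDimensional ℝ E]
  {M : Set E} {T : M → Submodule ℝ E} {τ : ℝ}

/-- Near `q`, every small tangent vector at `q` is the tangential part of `p - q` for a point
`p` of `M` at about the same distance. -/
theorem eventually_exists_starProjection_sub_eq (hτ : 0 < τ)
    (hfed : ∀ x y : M, 2 * τ * ‖(T x)ᗮ.starProjection ((y : E) - x)‖ ≤ ‖(y : E) - x‖ ^ 2)
    {q : M} (hq : 𝓝 0 ≤ map (fun p ↦ (T q).orthogonalProjectionOnto (p - q)) (𝓝[M] (q : E))) :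
    ∃ ε > 0, ∀ w ∈ T q, ‖w‖ < ε →
      ∃ p : M, (T q).starProjection ((p : E) - q) = w ∧ ‖(p : E) - q‖ ≤ 21 / 20 * ‖w‖ := by
  -- Within radius `2τ/21`, Federer's inequality makes the normal part of `p - q` at most `‖p - q‖ /
  -- 21`, whence the factor `21/20`.
  have h1 : (fun p ↦ (T q).orthogonalProjectionOnto (p - q)) '' (ball (q : E) (2 * τ / 21) ∩ M) ∈
      𝓝 (0 : T q) :=
    hq (image_mem_map (inter_mem (mem_nhdsWithin_of_mem_nhds
      (ball_mem_nhds _ (by positivity))) self_mem_nhdsWithin))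
  obtain ⟨ε, hε, hball⟩ := Metric.mem_nhds_iff.1 h1
  refine ⟨ε, hε, fun w hw hwε ↦ ?_⟩
  obtain ⟨p, ⟨hpb, hpM⟩, hp⟩ := hball (show (⟨w, hw⟩ : T q) ∈ ball 0 ε by simpa using hwε)
  have hp' : (T q).starProjection (p - q) = w := by
    rw [Submodule.starProjection_apply]; exact congrArg Subtype.val hp
  refine ⟨⟨p, hpM⟩, hp', ?_⟩
  rw [mem_ball, dist_eq_norm] at hpb
  have h2 := hfed q ⟨p, hpM⟩
  have h3 := Submodule.starProjection_add_starProjection_orthogonal (K := T q) (p - q)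
  have h4 := norm_add_le ((T q).starProjection (p - q)) ((T q)ᗮ.starProjection (p - q))
  rw [h3, hp'] at h4
  simp only at h2 ⊢
  have h5 : ‖(p - q : E)‖ ^ 2 ≤ (2 * τ / 21) * ‖(p - q : E)‖ := by
    nlinarith [norm_nonneg (p - q : E)]
  have h6 : τ * (2 * ‖(T q)ᗮ.starProjection (p - q : E)‖) ≤ τ * (2 / 21 * ‖(p - q : E)‖) := by
    linarith
  have := le_of_mul_le_mul_left h6 hτ
  linarith

/-- Tangent vectors at `q` make a small angle with the tangent space at nearby points. -/
theorem eventually_norm_normal_le (hτ : 0 < τ)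
    (hfed : ∀ x y : M, 2 * τ * ‖(T x)ᗮ.starProjection ((y : E) - x)‖ ≤ ‖(y : E) - x‖ ^ 2)
    {q : M} (hq : 𝓝 0 ≤ map (fun p ↦ (T q).orthogonalProjectionOnto (p - q)) (𝓝[M] (q : E))) :
    ∀ᶠ p in 𝓝 q, ∀ u ∈ T q, ‖(T p)ᗮ.starProjection u‖ ≤ 16 / 5 / τ * dist q p * ‖u‖ := by
  obtain ⟨ε, hε, h⟩ := eventually_exists_starProjection_sub_eq hτ hfed hq
  filter_upwards [ball_mem_nhds q hε] with p hp u hu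
  rcases eq_or_ne p q with rfl | hpq
  · rw [Submodule.starProjection_orthogonal_apply_eq_zero hu, norm_zero]
    positivity
  rcases eq_or_ne u 0 with rfl | hu0
  · simp
  have hupos : 0 < ‖u‖ := norm_pos_iff.2 hu0
  rw [dist_comm]
  rw [mem_ball] at hp
  set r := dist p q with hr
  have hrpos : 0 < r := dist_pos.2 hpq
  have hrn : ‖(p : E) - q‖ = r := by rw [hr, Subtype.dist_eq, dist_eq_norm]
  have hw : ‖(r / ‖u‖) • u‖ = r := by
    rw [norm_smul, Real.norm_of_nonneg (by positivity), div_mul_cancel₀ _ hupos.ne']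
  obtain ⟨p', hp', hn⟩ := h ((r / ‖u‖) • u) (Submodule.smul_mem _ _ hu) (by rwa [hw])
  rw [hw] at hn
  have e1 := Submodule.starProjection_add_starProjection_orthogonal (K := T q) ((p' : E) - q)
  rw [hp'] at e1
  -- The rescaled `u` is `(p' - p) - (q - p)` minus the normal part of `p' - q` at `q`. Federer's
  -- inequality, twice at `p` and once at `q`, makes every term quadratic in `r`.
  have e2 : (r / ‖u‖) • (T p)ᗮ.starProjection u =
      (T p)ᗮ.starProjection ((p' : E) - p) - (T p)ᗮ.starProjection ((q : E) - p) -
      (T p)ᗮ.starProjection ((T q)ᗮ.starProjection ((p' : E) - q)) := by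
    rw [← map_smul, ← map_sub, ← map_sub]
    congr 1
    rw [eq_sub_of_add_eq e1]
    abel
  have e3 := norm_sub_le ((T p)ᗮ.starProjection ((p' : E) - p) -
    (T p)ᗮ.starProjection ((q : E) - p)) ((T p)ᗮ.starProjection ((T q)ᗮ.starProjection ((p' : E) - q)))
  have e4 := norm_sub_le ((T p)ᗮ.starProjection ((p' : E) - p))
    ((T p)ᗮ.starProjection ((q : E) - p))
  have e5 := (T p)ᗮ.norm_starProjection_apply_le ((T q)ᗮ.starProjection ((p' : E) - q))
  rw [← e2, norm_smul, Real.norm_of_nonneg (by positivity)] at e3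
  have f1 := hfed p p'
  have f2 := hfed p q
  have f3 := hfed q p'
  rw [norm_sub_rev, hrn] at f2
  have g1 : ‖(p' : E) - p‖ ≤ 41 / 20 * r := by
    have := norm_sub_le ((p' : E) - q) ((p : E) - q)
    rw [sub_sub_sub_cancel_right, hrn] at this
    linarith
  have g2 : ‖(p' : E) - p‖ ^ 2 ≤ (41 / 20 * r) ^ 2 := pow_le_pow_left₀ (norm_nonneg _) g1 2
  have g3 : ‖(p' : E) - q‖ ^ 2 ≤ (21 / 20 * r) ^ 2 := pow_le_pow_left₀ (norm_nonneg _) hn 2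
  -- `(41/20)² + 1 + (21/20)² = 6.305 ≤ 32/5`.
  have k1 : 2 * τ * (r / ‖u‖ * ‖(T p)ᗮ.starProjection u‖) ≤ 32 / 5 * r ^ 2 := by
    have : 2 * τ * (r / ‖u‖ * ‖(T p)ᗮ.starProjection u‖) ≤
      2 * τ * (‖(T p)ᗮ.starProjection ((p' : E) - p)‖ + ‖(T p)ᗮ.starProjection ((q : E) - p)‖ +
        ‖(T q)ᗮ.starProjection ((p' : E) - q)‖) := by
      apply mul_le_mul_of_nonneg_left _ (by positivity)
      linarith
    nlinarith [sq_nonneg r]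
  have k2 : 2 * τ * (r / ‖u‖ * ‖(T p)ᗮ.starProjection u‖) =
      (2 * τ * r / ‖u‖) * ‖(T p)ᗮ.starProjection u‖ := by ring
  rw [k2] at k1
  have k3 : (2 * τ * r / ‖u‖) * (16 / 5 / τ * r * ‖u‖) = 32 / 5 * r ^ 2 := by
    field_simp; norm_num
  rw [← k3] at k1
  exact le_of_mul_le_mul_left k1 (by positivity)

/-- The tangential part of a fixed vector is locally Lipschitz in the base point. -/
theorem eventually_dist_norm_starProjection_le (hτ : 0 < τ)
    (hfed : ∀ x y : M, 2 * τ * ‖(T x)ᗮ.starProjection ((y : E) - x)‖ ≤ ‖(y : E) - x‖ ^ 2)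
    {q : M} (hq : 𝓝 0 ≤ map (fun p ↦ (T q).orthogonalProjectionOnto (p - q)) (𝓝[M] (q : E)))
    (hdim : ∀ p, Module.finrank ℝ (T q) = Module.finrank ℝ (T p)) (e : E) :
    ∀ᶠ p in 𝓝 q, dist ‖(T q).starProjection e‖ ‖(T p).starProjection e‖ ≤
      10 / 3 / τ * ‖e‖ * dist q p := by
  -- Radius `τ/80` gives `c ≤ 1/25`, so `c / (1 - c) ≤ 25/24 * c`, and `16/5 * 25/24 = 10/3`.
  filter_upwards [eventually_norm_normal_le hτ hfed hq,
    ball_mem_nhds q (show 0 < τ / 80 by positivity)] with p h hp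
  rw [mem_ball, dist_comm] at hp
  set r := dist q p with hr
  have hr0 : 0 ≤ r := dist_nonneg
  have hc : 16 / 5 / τ * r ≤ 1 / 25 := by
    rw [div_mul_eq_mul_div, div_le_iff₀ hτ]; linarith
  have hc0 : 0 ≤ 16 / 5 / τ * r := by positivity
  have hle1 : 16 / 5 / τ * r ≤ 10 / 3 / τ * r := by
    have : 10 / 3 / τ * r = (25 / 24) * (16 / 5 / τ * r) := by ring
    linarith
  have hle2 : 16 / 5 / τ * r / (1 - 16 / 5 / τ * r) ≤ 10 / 3 / τ * r := by
    rw [div_le_iff₀ (by linarith)]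
    have : 10 / 3 / τ * r = (25 / 24) * (16 / 5 / τ * r) := by ring
    rw [this]
    nlinarith
  have h1 : ∀ u ∈ T q, ‖(T p)ᗮ.starProjection u‖ ≤ 10 / 3 / τ * r * ‖u‖ := fun u hu ↦
    (h u hu).trans (mul_le_mul_of_nonneg_right hle1 (norm_nonneg _))
  have h2 : ∀ u ∈ T p, ‖(T q)ᗮ.starProjection u‖ ≤ 10 / 3 / τ * r * ‖u‖ := fun u hu ↦
    (Submodule.norm_starProjection_orthogonal_le_of_finrank_eq (hdim p) hc0 (by linarith) h hu).trans
      (mul_le_mul_of_nonneg_right hle2 (norm_nonneg _))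
  have h3 := (T q).norm_starProjection_le_add (T p) (hc0.trans hle1) h1 e
  have h4 := (T p).norm_starProjection_le_add (T q) (hc0.trans hle1) h2 e
  have h5 : 10 / 3 / τ * ‖e‖ * r = 10 / 3 / τ * r * ‖e‖ := by ring
  rw [Real.dist_eq, h5, abs_le]
  constructor <;> linarith

end LocalAngle

/-! ### Geometry at a bottleneck -/

section Bottleneck

open scoped RealInnerProductSpace

variable {E : Type*} [NormedAddCommGroup E] [InnerProductSpace ℝ E] [FiniteDimensional ℝ E]
  {M : Set E} {T : M → Submodule ℝ E} {τ : ℝ}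

/-- If `q` is a nearest point of `M` to `z`, at distance `τ`, then `z - q` is normal to `M`. -/
theorem starProjection_sub_eq_zero_of_forall_le (hτ : 0 < τ)
    (hfed : ∀ x y : M, 2 * τ * ‖(T x)ᗮ.starProjection ((y : E) - x)‖ ≤ ‖(y : E) - x‖ ^ 2)
    {q : M} (hq : 𝓝 0 ≤ map (fun p ↦ (T q).orthogonalProjectionOnto (p - q)) (𝓝[M] (q : E)))
    {z : E} (hz : ‖z - q‖ ≤ τ) (hmin : ∀ p ∈ M, τ ≤ ‖z - p‖) :
    (T q).starProjection (z - q) = 0 := by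
  by_contra hne
  set u := (T q).starProjection (z - q) with hu
  have hupos : 0 < ‖u‖ := norm_pos_iff.2 hne
  obtain ⟨ε, hε, h⟩ := eventually_exists_starProjection_sub_eq hτ hfed hq
  -- A displacement of about `t • u` lowers the squared distance to `z` by `2t‖u‖²`, up to two
  -- errors of at most `(21/20 t‖u‖)²`: the squared length and the normal part. For `t ≤ 1/2` the
  -- gain wins.
  set t := min (ε / (2 * ‖u‖)) (1 / 2) with ht
  have htpos : 0 < t := by positivity
  have ht2 : t ≤ 1 / 2 := min_le_right _ _
  have htn : ‖t • u‖ = t * ‖u‖ := by rw [norm_smul, Real.norm_of_nonneg htpos.le]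
  have htε : t * ‖u‖ < ε := by
    have h1 : t * ‖u‖ ≤ ε / (2 * ‖u‖) * ‖u‖ :=
      mul_le_mul_of_nonneg_right (min_le_left _ _) hupos.le
    have h2 : ε / (2 * ‖u‖) * ‖u‖ = ε / 2 := by field_simp
    linarith
  obtain ⟨p, hp, hpn⟩ := h (t • u)
    (Submodule.smul_mem _ _ (Submodule.starProjection_apply_mem _ _)) (htn ▸ htε)
  rw [htn] at hpn
  have e1 := Submodule.starProjection_add_starProjection_orthogonal (K := T q) ((p : E) - q)
  rw [hp] at e1
  have e2 : ⟪u, z - q⟫ = ‖u‖ ^ 2 := Submodule.re_inner_starProjection_eq_normSq (T q) (z - q)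
  have e3 : ⟪(p : E) - q, z - q⟫ =
      t * ‖u‖ ^ 2 + ⟪(T q)ᗮ.starProjection ((p : E) - q), z - q⟫ := by
    nth_rw 1 [← e1]
    rw [inner_add_left, real_inner_smul_left, e2]
  have e4 := abs_le.1 (abs_real_inner_le_norm ((T q)ᗮ.starProjection ((p : E) - q)) (z - q))
  have e5 : ‖(T q)ᗮ.starProjection ((p : E) - q)‖ * ‖z - q‖ ≤
      ‖(T q)ᗮ.starProjection ((p : E) - q)‖ * τ := mul_le_mul_of_nonneg_left hz (norm_nonneg _)
  have e6 := hfed q p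
  have e7 : ‖z - p‖ ^ 2 = ‖z - q‖ ^ 2 - 2 * ⟪(p : E) - q, z - q⟫ + ‖(p : E) - q‖ ^ 2 := by
    rw [← sub_sub_sub_cancel_right z (p : E) q, norm_sub_sq_real, real_inner_comm]
  have e8 : τ ^ 2 ≤ ‖z - p‖ ^ 2 := pow_le_pow_left₀ hτ.le (hmin p p.2) 2
  have e9 : ‖z - q‖ ^ 2 ≤ τ ^ 2 := pow_le_pow_left₀ (norm_nonneg _) hz 2
  have e10 : ‖(p : E) - q‖ ^ 2 ≤ (21 / 20 * (t * ‖u‖)) ^ 2 :=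
    pow_le_pow_left₀ (norm_nonneg _) hpn 2
  have e11 : 2 * (t * ‖u‖ ^ 2) ≤ 2 * (21 / 20 * (t * ‖u‖)) ^ 2 := by linarith
  have e12 : (t * ‖u‖ ^ 2) * 1 ≤ (t * ‖u‖ ^ 2) * (441 / 400 * t) := by nlinarith
  have := le_of_mul_le_mul_left e12 (by positivity)
  linarith

theorem bottleneck_estimate {S : Submodule ℝ E} {q₁ q₂ x y : E} {m : ℝ} (hτ : 0 < τ)
    (hq : ‖q₂ - q₁‖ = 2 * τ) (hx : ‖x - q₁‖ ≤ m) (hy : ‖y - q₂‖ ≤ m)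
    (hS : ‖S.starProjection (q₂ - q₁)‖ ≤ 20 / 3 * m) :
    (τ - 4 * m) * ‖y - x‖ ^ 2 ≤ 2 * τ ^ 2 * ‖Sᗮ.starProjection (y - x)‖ := by
  have hm : 0 ≤ m := (norm_nonneg _).trans hx
  rcases le_or_gt τ (4 * m) with h4 | h4
  · have h1 : (τ - 4 * m) * ‖y - x‖ ^ 2 ≤ 0 :=
      mul_nonpos_of_nonpos_of_nonneg (by linarith) (sq_nonneg _)
    exact h1.trans (by positivity)
  have hd : y - x = (q₂ - q₁) + ((y - q₂) - (x - q₁)) := by abel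
  have hd2 : ‖(y - q₂) - (x - q₁)‖ ≤ 2 * m := (norm_sub_le _ _).trans (by linarith)
  have h1 : ‖y - x‖ ≤ 2 * τ + 2 * m := by
    rw [hd]; exact (norm_add_le _ _).trans (by linarith)
  have h2 : ‖y - x‖ ^ 2 ≤ (2 * τ + 2 * m) ^ 2 := pow_le_pow_left₀ (norm_nonneg _) h1 2
  set a := ‖S.starProjection (q₂ - q₁)‖ with ha
  set b := ‖Sᗮ.starProjection (q₂ - q₁)‖ with hb
  have h3 : (2 * τ) ^ 2 = a ^ 2 + b ^ 2 := by
    rw [← hq]; exact Submodule.norm_sq_eq_add_norm_sq_starProjection _ S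
  have ha2 : a ^ 2 ≤ (20 / 3 * m) ^ 2 := pow_le_pow_left₀ (norm_nonneg _) hS 2
  have hb2 : b ≤ 2 * τ := by
    rw [← hq]; exact Submodule.norm_starProjection_apply_le _ _
  have h5 : b - 2 * m ≤ ‖Sᗮ.starProjection (y - x)‖ := by
    rw [hd, map_add]
    have k1 := norm_sub_le_norm_add (Sᗮ.starProjection (q₂ - q₁))
      (Sᗮ.starProjection ((y - q₂) - (x - q₁)))
    have k2 := Sᗮ.norm_starProjection_apply_le ((y - q₂) - (x - q₁))
    linarith
  -- Since `b ≤ 2τ`, `2τb ≥ b² = 4τ² - a²`; no square root is needed.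
  have h6 : 4 * τ ^ 2 - 400 / 9 * m ^ 2 ≤ 2 * τ * b := by
    nlinarith [norm_nonneg (Sᗮ.starProjection (q₂ - q₁))]
  have h7 : 2 * τ ^ 2 * (b - 2 * m) ≤ 2 * τ ^ 2 * ‖Sᗮ.starProjection (y - x)‖ :=
    mul_le_mul_of_nonneg_left h5 (by positivity)
  have h8 : (τ - 4 * m) * ‖y - x‖ ^ 2 ≤ (τ - 4 * m) * (2 * τ + 2 * m) ^ 2 :=
    mul_le_mul_of_nonneg_left h2 (by linarith)
  have h9 : τ * (4 * τ ^ 2 - 400 / 9 * m ^ 2) ≤ τ * (2 * τ * b) :=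
    mul_le_mul_of_nonneg_left h6 hτ.le
  have h10 : 0 ≤ m * (τ - 4 * m) * τ := by
    have : 0 ≤ τ - 4 * m := by linarith
    positivity
  have h11 : 0 ≤ m ^ 3 := by positivity
  nlinarith [h10, h11, mul_nonneg hm (sq_nonneg τ)]

end Bottleneck

/-! ### Assembly -/

theorem mainTheorem3 {d D : ℕ} (hd : 1 ≤ d) (hdD : d < D) {n : WithTop ℕ∞} (hn : 1 ≤ n)
    (M : Set (EuclideanSpace ℝ (Fin D)))
    [ChartedSpace (EuclideanSpace ℝ (Fin d)) M] [IsManifold (𝓡 d) n M]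
    (hM : Manifold.IsSmoothEmbedding (𝓡 d) 𝓘(ℝ, EuclideanSpace ℝ (Fin D)) n
      (Subtype.val : M → EuclideanSpace ℝ (Fin D)))
    (hMcompact : IsCompact M) (hMconn : IsConnected M)
    (hreach : 0 < Reach.reach M)
    (q₁ q₂ : M) (hq : Reach.IsBottleneck M q₁ q₂)
    (X : Set M) (x y : M) (hx : x ∈ X) (hy : y ∈ X)
    (hq₁x : edist q₁ x < Reach.reach M) (hq₂y : edist q₂ y < Reach.reach M) :
    0 ≤ Reach.recip (Reach.reach M) - Reach.recip (Reach.tauHat d M X) ∧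
    Reach.recip (Reach.reach M) - Reach.recip (Reach.tauHat d M X) ≤
      Reach.recip (Reach.reach M) - Reach.recip (Reach.tauHat d M {x, y}) ∧
    Reach.recip (Reach.reach M) - Reach.recip (Reach.tauHat d M {x, y}) ≤
      ((4 / Reach.reach M ^ 2 *
        max (Reach.geodesicEDist M q₁ x) (Reach.geodesicEDist M q₂ y) : ℝ≥0∞) : EReal) := by
  obtain ⟨⟨-, z₀, hz₀, hz₁, hz₂⟩, hq₁₂⟩ := hq
  have hRz : Reach.reach M ≤ infEDist z₀ M := iInf₂_le z₀ hz₀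
  have hRtop : Reach.reach M ≠ ⊤ := ne_top_of_le_ne_top (infEDist_ne_top (s := M) ⟨_, q₁.2⟩) hRz
  set τ := (Reach.reach M).toReal with hτdef
  have hR : Reach.reach M = ENNReal.ofReal τ := (ENNReal.ofReal_toReal hRtop).symm
  have hτ : 0 < τ := ENNReal.toReal_pos hreach.ne' hRtop
  have hfed := Reach.norm_normal_sub_le hn hM hMcompact hτ
  rw [← hτdef] at hfed
  have hsurj := Reach.nhds_le_map_orthogonalProjection hn hM
  have hzq : ∀ q : M, edist (q : EuclideanSpace ℝ (Fin D)) z₀ ≤ Reach.reach M →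
      ‖z₀ - q‖ ≤ τ := by
    intro q h
    rwa [hR, edist_dist, ENNReal.ofReal_le_ofReal_iff hτ.le, dist_comm, dist_eq_norm] at h
  have hmin : ∀ p ∈ M, τ ≤ ‖z₀ - p‖ := by
    intro p hp
    have h := hRz.trans (infEDist_le_edist_of_mem hp)
    rwa [hR, edist_dist, ENNReal.ofReal_le_ofReal_iff dist_nonneg, dist_eq_norm] at h
  have hq₁₂' : ‖(q₂ : EuclideanSpace ℝ (Fin D)) - q₁‖ = 2 * τ := by
    have h := congrArg ENNReal.toReal hq₁₂
    rw [ENNReal.toReal_mul, edist_dist, ENNReal.toReal_ofReal dist_nonneg, dist_comm,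
      Subtype.dist_eq, dist_eq_norm] at h
    simpa using h
  have hle₁ := hzq q₁ hz₁
  have hle₂ := hzq q₂ hz₂
  -- Two vectors of norm at most `τ` whose difference has norm `2τ` are opposite.
  have hmid : (q₂ : EuclideanSpace ℝ (Fin D)) - q₁ = (2 : ℝ) • (z₀ - q₁) := by
    have h1 := parallelogram_law_with_norm ℝ (z₀ - (q₁ : EuclideanSpace ℝ (Fin D))) (z₀ - q₂)
    rw [sub_sub_sub_cancel_left, hq₁₂'] at h1
    have h2 : ‖(z₀ - q₁ : EuclideanSpace ℝ (Fin D)) + (z₀ - q₂)‖ = 0 := by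
      have := norm_nonneg ((z₀ - q₁ : EuclideanSpace ℝ (Fin D)) + (z₀ - q₂))
      have := norm_nonneg (z₀ - q₁ : EuclideanSpace ℝ (Fin D))
      have := norm_nonneg (z₀ - q₂ : EuclideanSpace ℝ (Fin D))
      nlinarith
    rw [norm_eq_zero] at h2
    have h3 : (q₂ : EuclideanSpace ℝ (Fin D)) - q₁ =
      (2 : ℝ) • (z₀ - (q₁ : EuclideanSpace ℝ (Fin D))) - ((z₀ - q₁) + (z₀ - q₂)) := by
      rw [two_smul]; abel
    rw [h3, h2, sub_zero]
  have hnormal : (Reach.tangent d M q₁).starProjection ((q₂ : EuclideanSpace ℝ (Fin D)) - q₁) = 0 := by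
    rw [hmid, map_smul, starProjection_sub_eq_zero_of_forall_le hτ hfed (hsurj q₁) hle₁ hmin,
      smul_zero]
  have hterm : ∀ x y : M, 2 * infEDist ((y : EuclideanSpace ℝ (Fin D)) - x)
      (Reach.tangent d M x : Set (EuclideanSpace ℝ (Fin D))) = ENNReal.ofReal
        (2 * ‖(Reach.tangent d M x)ᗮ.starProjection ((y : EuclideanSpace ℝ (Fin D)) - x)‖) := by
    intro x y
    rw [Submodule.infEDist_eq_norm_starProjection_orthogonal, ENNReal.ofReal_mul zero_le_two]
    simp
  have henorm : ∀ x y : M, ‖(y : EuclideanSpace ℝ (Fin D)) - x‖ₑ ^ 2 =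
      ENNReal.ofReal (‖(y : EuclideanSpace ℝ (Fin D)) - x‖ ^ 2) := by
    intro x y
    rw [ENNReal.ofReal_pow (norm_nonneg _), ofReal_norm]
  have hrecip : Reach.recip (Reach.reach M) ≠ ⊤ := by
    simp [Reach.recip, hreach.ne']
  have hmono : Reach.tauHat d M X ≤ Reach.tauHat d M {x, y} := by
    have hsub : ∀ z ∈ ({x, y} : Set M), z ∈ X := by
      rintro z (rfl | rfl) <;> assumption
    exact le_iInf₂ fun a ha ↦ le_iInf₂ fun b hb ↦
      (iInf₂_le a (hsub a ha)).trans (iInf₂_le b (hsub b hb))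
  refine ⟨?_, ?_, ?_⟩
  · have h1 : Reach.reach M ≤ Reach.tauHat d M X := by
      refine le_iInf₂ fun a _ ↦ le_iInf₂ fun b _ ↦ le_iInf fun hab ↦ ?_
      have hne : ‖(b : EuclideanSpace ℝ (Fin D)) - a‖ ≠ 0 := by
        rw [norm_ne_zero_iff, sub_ne_zero]; exact fun h ↦ hab (Subtype.ext h.symm)
      rw [hterm, henorm, hR, ENNReal.le_div_iff_mul_le (Or.inr (by
        rw [ne_eq, ENNReal.ofReal_eq_zero, not_le]; positivity)) (Or.inl ENNReal.ofReal_ne_top),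
        ← ENNReal.ofReal_mul hτ.le]
      apply ENNReal.ofReal_le_ofReal
      have := hfed a b
      linarith
    have h2 : Reach.recip (Reach.tauHat d M X) ≤ Reach.recip (Reach.reach M) := by
      exact EReal.coe_ennreal_le_coe_ennreal_iff.2 (ENNReal.inv_le_inv.2 h1)
    rw [EReal.sub_nonneg (Or.inl hrecip) (Or.inl (by simp [Reach.recip]))]
    exact h2
  · exact EReal.sub_le_sub le_rfl
      (EReal.coe_ennreal_le_coe_ennreal_iff.2 (ENNReal.inv_le_inv.2 hmono))
  · suffices h : (Reach.reach M)⁻¹ ≤ 4 / Reach.reach M ^ 2 *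
        max (Reach.geodesicEDist M q₁ x) (Reach.geodesicEDist M q₂ y) +
        (Reach.tauHat d M {x, y})⁻¹ by
      refine EReal.sub_le_of_le_add ?_
      rw [Reach.recip, Reach.recip, ← EReal.coe_ennreal_add]
      exact EReal.coe_ennreal_le_coe_ennreal_iff.2 h
    set G := max (Reach.geodesicEDist M q₁ x) (Reach.geodesicEDist M q₂ y) with hG
    rcases eq_or_ne G ⊤ with hGt | hGt
    · rw [hGt, ENNReal.mul_top (by simp [ENNReal.div_eq_zero_iff, hRtop]), top_add]
      exact le_top
    set m := G.toReal with hm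
    have hGm : G = ENNReal.ofReal m := (ENNReal.ofReal_toReal hGt).symm
    have hm0 : 0 ≤ m := ENNReal.toReal_nonneg
    have hdist : ∀ p q : M, Reach.geodesicEDist M p q ≤ G →
        ‖(q : EuclideanSpace ℝ (Fin D)) - p‖ ≤ m := by
      intro p q h
      have h1 := edist_le_mul_geodesicEDist (s := (Subtype.val : M → EuclideanSpace ℝ (Fin D)))
        one_ne_zero (fun q ↦ Eventually.of_forall fun p ↦ by simp [Subtype.dist_eq]) p q
      rw [ENNReal.coe_one, one_mul] at h1
      have h2 := h1.trans h
      rwa [hGm, edist_dist, ENNReal.ofReal_le_ofReal_iff hm0, dist_comm, dist_eq_norm] at h2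
    have hx' := hdist q₁ x (le_max_left _ _)
    have hy' := hdist q₂ y (le_max_right _ _)
    -- The tangential part of `q₂ - q₁` vanishes at `q₁` and grows at rate at most `10/(3τ) * 2τ =
    -- 20/3`.
    have hS : ‖(Reach.tangent d M x).starProjection ((q₂ : EuclideanSpace ℝ (Fin D)) - q₁)‖ ≤
        20 / 3 * m := by
      have h1 := edist_le_mul_geodesicEDist (M := M) (K := 20 / 3) (by norm_num)
        (s := fun p ↦ ‖(Reach.tangent d M p).starProjection
          ((q₂ : EuclideanSpace ℝ (Fin D)) - q₁)‖) (fun q ↦ by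
          have h2 := eventually_dist_norm_starProjection_le hτ hfed (hsurj q)
            (fun p ↦ (Reach.finrank_tangent hn hM q).trans (Reach.finrank_tangent hn hM p).symm)
            ((q₂ : EuclideanSpace ℝ (Fin D)) - q₁)
          rw [hq₁₂'] at h2
          have h3 : 10 / 3 / τ * (2 * τ) = ((20 / 3 : NNReal) : ℝ) := by
            push_cast; field_simp; norm_num
          rwa [h3] at h2) q₁ x
      have h2 := h1.trans (mul_le_mul_right (le_max_left _ (Reach.geodesicEDist M q₂ y)) _)
      rw [← hG, hGm, hnormal, norm_zero, edist_dist, ← ENNReal.ofReal_coe_nnreal,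
        ← ENNReal.ofReal_mul (NNReal.coe_nonneg _),
        ENNReal.ofReal_le_ofReal_iff (by positivity)] at h2
      simpa using h2
    have hest := bottleneck_estimate hτ hq₁₂' hx' hy' hS
    -- A common point would lie at distance less than `τ` from both `q₁` and `q₂`.
    have hxy : x ≠ y := by
      rintro rfl
      have h1 := (edist_triangle_right q₁ q₂ x).trans_lt (ENNReal.add_lt_add hq₁x hq₂y)
      rw [hq₁₂, two_mul] at h1
      exact lt_irrefl _ h1
    have hr : 0 < ‖(y : EuclideanSpace ℝ (Fin D)) - x‖ := by
      rw [norm_pos_iff, sub_ne_zero]; exact fun h ↦ hxy (Subtype.ext h.symm)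
    set r := ‖(y : EuclideanSpace ℝ (Fin D)) - x‖ with hrdef
    set δ := ‖(Reach.tangent d M x)ᗮ.starProjection ((y : EuclideanSpace ℝ (Fin D)) - x)‖ with hδ
    have hhat : ENNReal.ofReal (2 * δ / r ^ 2) ≤ (Reach.tauHat d M {x, y})⁻¹ := by
      have h1 : Reach.tauHat d M {x, y} ≤ ENNReal.ofReal (r ^ 2) / ENNReal.ofReal (2 * δ) := by
        rw [← henorm, ← hterm]
        exact (iInf₂_le x (by simp)).trans ((iInf₂_le y (by simp)).trans (iInf_le _ hxy))
      refine le_trans ?_ (ENNReal.inv_le_inv.2 h1)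
      rw [ENNReal.inv_div (Or.inl ENNReal.ofReal_ne_top)
        (Or.inr (by rw [ne_eq, ENNReal.ofReal_eq_zero, not_le]; positivity)),
        ENNReal.ofReal_div_of_pos (by positivity)]
    refine le_trans ?_ (add_le_add_right hhat _)
    have hlhs : (Reach.reach M)⁻¹ = ENNReal.ofReal τ⁻¹ := by
      rw [hR, ENNReal.ofReal_inv_of_pos hτ]
    have hrhs : 4 / Reach.reach M ^ 2 * G = ENNReal.ofReal (4 / τ ^ 2 * m) := by
      rw [hR, hGm, ENNReal.ofReal_mul (by positivity), ENNReal.ofReal_div_of_pos (by positivity),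
        ENNReal.ofReal_pow hτ.le]
      simp
    rw [hlhs, hrhs, ← ENNReal.ofReal_add (by positivity) (by positivity)]
    apply ENNReal.ofReal_le_ofReal
    have h1 : (τ - 4 * m) / τ ^ 2 ≤ 2 * δ / r ^ 2 := by
      rw [div_le_div_iff₀ (by positivity) (by positivity)]
      linarith
    have h2 : τ⁻¹ = 4 / τ ^ 2 * m + (τ - 4 * m) / τ ^ 2 := by
      field_simp; ring
    linarith
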